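/- Let $\mathrm{Nil}_3$ be the Heisenberg group, i.e. $\mathbb{R}^3$ with the group operation $$(x,y,z)*(\bar x,\bar y,\bar z)=\Big(x+\bar x,\ y+\bar y,\ z+\bar z+\tfrac{x\bar y}{2}-\tfrac{\bar x y}{2}\Big)$$ and the left-invariant Riemannian metric $\tilde g=dx^2+dy^2+\big(dz+\tfrac12(y\,dx-x\,dy)\big)^2$. Let $I,J\subseteq\mathbb{R}$ be non-empty open intervals, let $u:I\to\mathbb{R}$ and $v:J\to\mathbb{R}$ be smooth ($C^\infty$) functions, and consider the translation surface of type 6, parametrized on $I\times J$ by $$r(x,y)=(y,v(y),0)*(0,x,u(x))=\Big(y,\ x+v(y),\ u(x)+\frac{xy}{2}\Big).$$ Then $r$ is a minimal surface in $(\mathrm{Nil}_3,\tilde g)$ (an immersion whose mean curvature vanishes identically) if and only if one of the following holds: (i) there are $u_0,a,b\in\mathbb{R}$, with $a=0$ in case $0\in J$, such that $u(x)=u_0$ for all $x\in I$ and $v(y)=\frac ay+b$ for all $y\in J$ (for $a=0$ this means $v(y)=b$); (ii) there are $a,b,c,c_1\in\mathbb{R}$ such that $v(y)=ay+b$ for all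 $y\in J$ and $$u(x)=\frac{ax^2+abx+c}{2(1+a^2)}+c_1\Big(\frac x2+\frac b4\Big)\sqrt{4(1+a^2)+(2x+b)^2}+c_1(1+a^2)\ln\Big(2x+b+\sqrt{4(1+a^2)+(2x+b)^2}\Big)$$ for all $x\in I$. -/

import Mathlib

open Set
open scoped ContDiff

/-- The underlying manifold `ℝ³` of the Heisenberg group, in its global coordinates. -/
abbrev Nil3 : Type := Fin 3 → ℝ

namespace Nil3

/-- The group operation of the Heisenberg group. -/
noncomputable def mul (p q : Nil3) : Nil3 :=
  ![p 0 + q 0, p 1 + q 1, p 2 + q 2 + p 0 * q 1 / 2 - q 0 * p 1 / 2]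

/-- The one-form `dz + (y dx - x dy) / 2` at the point `p`, applied to a tangent vector `X`. -/
noncomputable def contactForm (p X : Nil3) : ℝ :=
  X 2 + (p 1 * X 0 - p 0 * X 1) / 2

/-- The left-invariant metric `dx² + dy² + (dz + (y dx - x dy) / 2)²` at the point `p`. -/
noncomputable def metric (p X Y : Nil3) : ℝ :=
  X 0 * Y 0 + X 1 * Y 1 + contactForm p X * contactForm p Y

/-- The coordinate matrix `(g_ij)` of the metric at `p`. -/
noncomputable def metricMatrix (p : Nil3) : Matrix (Fin 3) (Fin 3) ℝ :=
  Matrix.of fun i j => metric p (Pi.single i 1) (Pi.single j 1)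

/-- The partial derivative `∂_l g_ij` at `p`. -/
noncomputable def dMetric (p : Nil3) (l i j : Fin 3) : ℝ :=
  fderiv ℝ (fun p' : Nil3 => metricMatrix p' i j) p (Pi.single l 1)

/-- The Christoffel symbols `Γ^k_ij` of the Levi-Civita connection of the metric. -/
noncomputable def christoffel (p : Nil3) (k i j : Fin 3) : ℝ :=
  (1 / 2) * ∑ l, (metricMatrix p)⁻¹ k l * (dMetric p i j l + dMetric p j i l - dMetric p l i j)

/-- The two coordinate directions of the parameter plane. -/
def direction : Fin 2 → ℝ × ℝ := ![(1, 0), (0, 1)]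

/-- The coordinate tangent vector fields `r_x` (index `0`) and `r_y` (index `1`) of a
parametrized surface `r`. -/
noncomputable def tangent (r : ℝ × ℝ → Nil3) (a : Fin 2) (q : ℝ × ℝ) : Nil3 :=
  fderiv ℝ r q (direction a)

/-- The Levi-Civita covariant derivative of the field `r_b` along the surface `r`, in the
direction `r_a`. -/
noncomputable def covDeriv (r : ℝ × ℝ → Nil3) (a b : Fin 2) (q : ℝ × ℝ) : Nil3 := fun k =>
  fderiv ℝ (tangent r b) q (direction a) k +
    ∑ i, ∑ j, christoffel (r q) k i j * tangent r a q i * tangent r b q j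

/-- The matrix of the first fundamental form in the basis `r_x, r_y`. -/
noncomputable def firstForm (r : ℝ × ℝ → Nil3) (q : ℝ × ℝ) : Matrix (Fin 2) (Fin 2) ℝ :=
  Matrix.of fun a b => metric (r q) (tangent r a q) (tangent r b q)

/-- The matrix of the second fundamental form with respect to a normal vector `N` at `r q`. -/
noncomputable def secondForm (r : ℝ × ℝ → Nil3) (q : ℝ × ℝ) (N : Nil3) :
    Matrix (Fin 2) (Fin 2) ℝ :=
  Matrix.of fun a b => metric (r q) (covDeriv r a b q) N

/-- `N` is a unit normal vector of the surface `r` at the parameter `q`. -/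
def IsUnitNormal (r : ℝ × ℝ → Nil3) (q : ℝ × ℝ) (N : Nil3) : Prop :=
  metric (r q) N N = 1 ∧ ∀ a, metric (r q) (tangent r a q) N = 0

/-- The mean curvature, half the trace of the shape operator, with respect to the unit
normal `N`. -/
noncomputable def meanCurvature (r : ℝ × ℝ → Nil3) (q : ℝ × ℝ) (N : Nil3) : ℝ :=
  (1 / 2) * ((firstForm r q)⁻¹ * secondForm r q N).trace

/-- `r` restricted to the parameter domain `U` is a minimal surface: a smooth immersion whose
mean curvature vanishes identically (for either choice of the unit normal). -/
def IsMinimal (r : ℝ × ℝ → Nil3) (U : Set (ℝ × ℝ)) : Prop :=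
  ContDiffOn ℝ ∞ r U ∧
  ∀ q ∈ U, LinearIndependent ℝ (fun a => tangent r a q) ∧
    ∀ N, IsUnitNormal r q N → meanCurvature r q N = 0

/-- The translation surface of type 6: `r (x, y) = (y, v y, 0) * (0, x, u x)`. -/
noncomputable def type6Surface (u v : ℝ → ℝ) (q : ℝ × ℝ) : Nil3 :=
  mul ![q.2, v q.2, 0] ![0, q.1, u q.1]

end Nil3

/-! ### The Levi-Civita connection of the Heisenberg group. -/

namespace Nil3

/-! In the orthonormal coframe formed by dx, dy and `contactForm`, the tangents are r_x = (0, 1, p)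
and r_y = (1, q, w), where p = u', q = v' and w = x + (v - y v') / 2. Their cross product (w - pq,
p, -1) is normal, and the mean curvature is a nonzero multiple of `minimalDefect`. Minimality is
therefore the equation (1 + q² + w²) p' = (1 + p²) (p + y/2) q' + p w + q.

If v'' = 0 throughout, then v = ay + b and this is a linear first-order equation for p; two
integrations give family (ii).

If v'' is nonzero somewhere, differentiate in y where it is nonzero, dividing by v'' after the first
step. For a fixed y the second derivative gives (x - B) p' as a polynomial in p. The third is free
of x and, unless its coefficient of p' vanishes, gives p' as a polynomial in p. The two are
compatible only if p' = 0 (`deriv_eq_zero_of_two_odes`); the degenerate case is settled directly in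
`eq_zero_of_curved`. With p constant, the x-derivative of the equation says p = 0. What remains is y
v''/2 + v' = 0, so y² v' is constant, which is family (i).

The converse is substitution. -/

lemma metricMatrix_apply (p : Nil3) : metricMatrix p =
    !![1 + p 1 ^ 2 / 4, -(p 0 * p 1) / 4, p 1 / 2;
       -(p 0 * p 1) / 4, 1 + p 0 ^ 2 / 4, -p 0 / 2;
       p 1 / 2, -p 0 / 2, 1] := by
  ext i j
  fin_cases i <;> fin_cases j <;> simp [metricMatrix, metric, contactForm] <;> ring

lemma metricMatrix_inv (p : Nil3) : (metricMatrix p)⁻¹ =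
    !![1, 0, -p 1 / 2;
       0, 1, p 0 / 2;
       -p 1 / 2, p 0 / 2, 1 + p 0 ^ 2 / 4 + p 1 ^ 2 / 4] := by
  apply Matrix.inv_eq_right_inv
  rw [metricMatrix_apply]
  ext i j
  fin_cases i <;> fin_cases j <;> simp [Matrix.mul_apply, Fin.sum_univ_three] <;> ring

lemma hasFDerivAt_coord (p : Nil3) (i : Fin 3) :
    HasFDerivAt (fun p' : Nil3 => p' i) (ContinuousLinearMap.proj (R := ℝ) i) p :=
  hasFDerivAt_apply i p

/-- The partial derivatives of the coefficients of the metric. -/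
lemma dMetric_eq (p : Nil3) :
    Matrix.of (dMetric p 0) =
      !![0, -p 1 / 4, 0; -p 1 / 4, p 0 / 2, -1 / 2; 0, -1 / 2, 0] ∧
    Matrix.of (dMetric p 1) = !![p 1 / 2, -p 0 / 4, 1 / 2; -p 0 / 4, 0, 0; 1 / 2, 0, 0] ∧
    Matrix.of (dMetric p 2) = 0 := by
  have h0 := hasFDerivAt_coord p 0
  have h1 := hasFDerivAt_coord p 1
  have e00 : HasFDerivAt (fun p' : Nil3 => 1 + p' 1 ^ 2 / 4) _ p :=
    ((h1.pow 2).mul_const (4 : ℝ)⁻¹).const_add 1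
  have e11 : HasFDerivAt (fun p' : Nil3 => 1 + p' 0 ^ 2 / 4) _ p :=
    ((h0.pow 2).mul_const (4 : ℝ)⁻¹).const_add 1
  have e01 : HasFDerivAt (fun p' : Nil3 => -(p' 0 * p' 1) / 4) _ p :=
    (h0.mul h1).neg.mul_const (4 : ℝ)⁻¹
  have e02 : HasFDerivAt (fun p' : Nil3 => p' 1 / 2) _ p := h1.mul_const (2 : ℝ)⁻¹
  have e12 : HasFDerivAt (fun p' : Nil3 => -p' 0 / 2) _ p := h0.neg.mul_const (2 : ℝ)⁻¹
  refine ⟨?_, ?_, ?_⟩ <;> ext i j <;> simp only [Matrix.of_apply, dMetric, metricMatrix_apply] <;>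
    fin_cases i <;> fin_cases j <;>
    simp [e00.fderiv, e01.fderiv, e02.fderiv, e11.fderiv, e12.fderiv] <;> ring

/-- The quadratic part of the Levi-Civita connection in coordinates. -/
lemma christoffel_sum (p X Y : Nil3) :
    (fun k => ∑ i, ∑ j, christoffel p k i j * X i * Y j) =
    ![(X 1 * contactForm p Y + contactForm p X * Y 1) / 2,
      -(X 0 * contactForm p Y + contactForm p X * Y 0) / 2,
      -(p 1 * (X 1 * contactForm p Y + contactForm p X * Y 1) +
        p 0 * (X 0 * contactForm p Y + contactForm p X * Y 0)) / 4] := by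
  obtain ⟨h0, h1, h2⟩ := dMetric_eq p
  have d0 : ∀ i j, dMetric p 0 i j =
      !![0, -p 1 / 4, 0; -p 1 / 4, p 0 / 2, -1 / 2; 0, -1 / 2, 0] i j := fun i j =>
    congrFun (congrFun h0 i) j
  have d1 : ∀ i j, dMetric p 1 i j =
      !![p 1 / 2, -p 0 / 4, 1 / 2; -p 0 / 4, 0, 0; 1 / 2, 0, 0] i j := fun i j =>
    congrFun (congrFun h1 i) j
  have d2 : ∀ i j, dMetric p 2 i j = 0 := fun i j => congrFun (congrFun h2 i) j
  ext k
  simp only [christoffel, metricMatrix_inv, contactForm, Fin.sum_univ_three, d0, d1, d2]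
  fin_cases k <;> simp <;> ring

lemma hasFDerivAt_vec3 {E : Type*} [NormedAddCommGroup E] [NormedSpace ℝ E]
    {f g h : E → ℝ} {f' g' h' : E →L[ℝ] ℝ} {q : E}
    (hf : HasFDerivAt f f' q) (hg : HasFDerivAt g g' q) (hh : HasFDerivAt h h' q) :
    HasFDerivAt (fun q => (![f q, g q, h q] : Nil3))
      (ContinuousLinearMap.pi ![f', g', h']) q := by
  rw [hasFDerivAt_pi']
  intro i
  fin_cases i
  · exact hf
  · exact hg
  · exact hh

lemma type6Surface_apply (u v : ℝ → ℝ) (x y : ℝ) :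
    type6Surface u v (x, y) = ![y, x + v y, u x + x * y / 2] := by
  ext i
  fin_cases i <;> simp [type6Surface, mul] <;> ring

/-- Invertibility is not needed: for determinant zero both sides are 0 by convention. -/
lemma trace_inv_mul_fin_two (A B : Matrix (Fin 2) (Fin 2) ℝ) :
    (A⁻¹ * B).trace =
      (A 0 0 * A 1 1 - A 0 1 * A 1 0)⁻¹ *
        (A 1 1 * B 0 0 - A 0 1 * B 1 0 - A 1 0 * B 0 1 + A 0 0 * B 1 1) := by
  rw [Matrix.inv_def, Matrix.adjugate_fin_two, Matrix.trace_fin_two, Matrix.det_fin_two,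
    Ring.inverse_eq_inv']
  simp [Matrix.mul_apply, Fin.sum_univ_two]
  ring

/-! ### Normal vector and mean curvature of the surface. -/

section Surface

variable {u v : ℝ → ℝ} {x y : ℝ}

lemma type6Surface_eq (u v : ℝ → ℝ) :
    type6Surface u v = fun q => ![q.2, q.1 + v q.2, u q.1 + q.1 * q.2 / 2] := by
  funext q
  exact type6Surface_apply u v q.1 q.2

lemma tangent_type6Surface (hu : DifferentiableAt ℝ u x) (hv : DifferentiableAt ℝ v y) :
    tangent (type6Surface u v) 0 (x, y) = ![0, 1, deriv u x + y / 2] ∧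
    tangent (type6Surface u v) 1 (x, y) = ![1, deriv v y, x / 2] := by
  have h1 : HasFDerivAt (fun q : ℝ × ℝ => q.1) (ContinuousLinearMap.fst ℝ ℝ ℝ) (x, y) :=
    hasFDerivAt_fst
  have h2 : HasFDerivAt (fun q : ℝ × ℝ => q.2) (ContinuousLinearMap.snd ℝ ℝ ℝ) (x, y) :=
    hasFDerivAt_snd
  have hu' : HasFDerivAt (fun q : ℝ × ℝ => u q.1) _ (x, y) :=
    HasDerivAt.comp_hasFDerivAt (x, y) (f := fun q : ℝ × ℝ => q.1) hu.hasDerivAt h1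
  have hv' : HasFDerivAt (fun q : ℝ × ℝ => v q.2) _ (x, y) :=
    HasDerivAt.comp_hasFDerivAt (x, y) (f := fun q : ℝ × ℝ => q.2) hv.hasDerivAt h2
  have key := ((hasFDerivAt_vec3 h2 (h1.add hv')
    (hu'.add ((h1.mul h2).mul_const (2 : ℝ)⁻¹))).congr_of_eventuallyEq (f₁ := type6Surface u v)
    (.of_forall fun q => type6Surface_apply u v q.1 q.2)).fderiv
  constructor <;> ext i <;> fin_cases i <;>
    simp [tangent, key, direction] <;> ring

/-- Only the coordinate part of `covDeriv`; the connection terms come from `christoffel_sum`. -/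
lemma covDeriv_type6Surface
    (hu : ∀ᶠ t in nhds x, DifferentiableAt ℝ u t) (hv : ∀ᶠ t in nhds y, DifferentiableAt ℝ v t)
    (hu2 : DifferentiableAt ℝ (deriv u) x) (hv2 : DifferentiableAt ℝ (deriv v) y) :
    fderiv ℝ (tangent (type6Surface u v) 0) (x, y) (direction 0) = ![0, 0, deriv (deriv u) x] ∧
    fderiv ℝ (tangent (type6Surface u v) 0) (x, y) (direction 1) = ![0, 0, 1 / 2] ∧
    fderiv ℝ (tangent (type6Surface u v) 1) (x, y) (direction 0) = ![0, 0, 1 / 2] ∧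
    fderiv ℝ (tangent (type6Surface u v) 1) (x, y) (direction 1) =
      ![0, deriv (deriv v) y, 0] := by
  have h1 : HasFDerivAt (fun q : ℝ × ℝ => q.1) (ContinuousLinearMap.fst ℝ ℝ ℝ) (x, y) :=
    hasFDerivAt_fst
  have h2 : HasFDerivAt (fun q : ℝ × ℝ => q.2) (ContinuousLinearMap.snd ℝ ℝ ℝ) (x, y) :=
    hasFDerivAt_snd
  have hu' : HasFDerivAt (fun q : ℝ × ℝ => deriv u q.1) _ (x, y) :=
    HasDerivAt.comp_hasFDerivAt (x, y) (f := fun q : ℝ × ℝ => q.1) hu2.hasDerivAt h1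
  have hv' : HasFDerivAt (fun q : ℝ × ℝ => deriv v q.2) _ (x, y) :=
    HasDerivAt.comp_hasFDerivAt (x, y) (f := fun q : ℝ × ℝ => q.2) hv2.hasDerivAt h2
  -- The tangent fields are differentiated again, so their formulas are needed on a neighbourhood.
  have hev : ∀ᶠ q : ℝ × ℝ in nhds (x, y),
      DifferentiableAt ℝ u q.1 ∧ DifferentiableAt ℝ v q.2 := by
    rw [nhds_prod_eq]
    exact hu.prod_mk hv
  have t0 : tangent (type6Surface u v) 0 =ᶠ[nhds (x, y)]
      fun q => ![0, 1, deriv u q.1 + q.2 / 2] :=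
    hev.mono fun q hq => (tangent_type6Surface hq.1 hq.2).1
  have t1 : tangent (type6Surface u v) 1 =ᶠ[nhds (x, y)]
      fun q => ![1, deriv v q.2, q.1 / 2] :=
    hev.mono fun q hq => (tangent_type6Surface hq.1 hq.2).2
  have k0 := hasFDerivAt_vec3 (hasFDerivAt_const (0 : ℝ) (x, y)) (hasFDerivAt_const (1 : ℝ) (x, y))
    (hu'.add (h2.mul_const (2 : ℝ)⁻¹))
  have k1 := hasFDerivAt_vec3 (hasFDerivAt_const (1 : ℝ) (x, y)) hv' (h1.mul_const (2 : ℝ)⁻¹)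
  have k0' := (k0.congr_of_eventuallyEq t0).fderiv
  have k1' := (k1.congr_of_eventuallyEq t1).fderiv
  rw [k0', k1']
  refine ⟨?_, ?_, ?_, ?_⟩ <;> ext i <;> fin_cases i <;> simp [direction]

/-- The minimal surface equation of the surface of type 6. -/
noncomputable def minimalDefect (u v : ℝ → ℝ) (x y : ℝ) : ℝ :=
  -(1 + deriv v y ^ 2 + (x + (v y - y * deriv v y) / 2) ^ 2) * deriv (deriv u) x +
    (1 + deriv u x ^ 2) * (deriv u x + y / 2) * deriv (deriv v) y +
    deriv u x * (x + (v y - y * deriv v y) / 2) + deriv v y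

/-- In the orthonormal coframe a normal vector is a multiple t of (0, 1, p) × (1, q, w) = (w - pq,
p, -1). -/
lemma isUnitNormal_type6Surface (hu : DifferentiableAt ℝ u x) (hv : DifferentiableAt ℝ v y)
    (N : Nil3) : IsUnitNormal (type6Surface u v) (x, y) N ↔
      ∃ t : ℝ, t ^ 2 * ((x + (v y - y * deriv v y) / 2 - deriv u x * deriv v y) ^ 2 +
        deriv u x ^ 2 + 1) = 1 ∧
        N 0 = t * (x + (v y - y * deriv v y) / 2 - deriv u x * deriv v y) ∧
        N 1 = t * deriv u x ∧
        contactForm (type6Surface u v (x, y)) N = -t := by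
  obtain ⟨t0, t1⟩ := tangent_type6Surface hu hv
  simp only [IsUnitNormal, Fin.forall_fin_two, t0, t1, metric]
  set c := contactForm (type6Surface u v (x, y)) N with hc
  have c0 : contactForm (type6Surface u v (x, y)) ![0, 1, deriv u x + y / 2] = deriv u x := by
    simp [type6Surface_apply, contactForm]; ring
  have c1 : contactForm (type6Surface u v (x, y)) ![1, deriv v y, x / 2] =
      x + (v y - y * deriv v y) / 2 := by
    simp [type6Surface_apply, contactForm]; ring
  rw [c0, c1]
  simp only [Matrix.cons_val_zero, Matrix.cons_val_one, zero_mul, one_mul, zero_add]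
  constructor
  · rintro ⟨h1, h2, h3⟩
    have e1 : N 1 = -c * deriv u x := by linarith
    have e0 : N 0 = -c * (x + (v y - y * deriv v y) / 2 - deriv u x * deriv v y) := by
      rw [e1] at h3; linarith
    refine ⟨-c, ?_, e0, e1, by ring⟩
    rw [e0, e1] at h1
    linarith
  · rintro ⟨t, h, e0, e1, e2⟩
    rw [e0, e1, e2]
    refine ⟨by linarith, by ring, by ring⟩

lemma meanCurvature_type6Surface
    (hu : ∀ᶠ t in nhds x, DifferentiableAt ℝ u t) (hv : ∀ᶠ t in nhds y, DifferentiableAt ℝ v t)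
    (hu2 : DifferentiableAt ℝ (deriv u) x) (hv2 : DifferentiableAt ℝ (deriv v) y)
    {N : Nil3} {t : ℝ}
    (h0 : N 0 = t * (x + (v y - y * deriv v y) / 2 - deriv u x * deriv v y))
    (h1 : N 1 = t * deriv u x)
    (h2 : contactForm (type6Surface u v (x, y)) N = -t) :
    meanCurvature (type6Surface u v) (x, y) N =
      t / (2 * ((x + (v y - y * deriv v y) / 2 - deriv u x * deriv v y) ^ 2 +
        deriv u x ^ 2 + 1)) * minimalDefect u v x y := by
  obtain ⟨t0, t1⟩ := tangent_type6Surface hu.self_of_nhds hv.self_of_nhds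
  obtain ⟨d00, d10, d01, d11⟩ := covDeriv_type6Surface hu hv hu2 hv2
  have c0 : contactForm (type6Surface u v (x, y)) ![0, 1, deriv u x + y / 2] = deriv u x := by
    simp [type6Surface_apply, contactForm]; ring
  have c1 : contactForm (type6Surface u v (x, y)) ![1, deriv v y, x / 2] =
      x + (v y - y * deriv v y) / 2 := by
    simp [type6Surface_apply, contactForm]; ring
  have hcov : ∀ a b, covDeriv (type6Surface u v) a b (x, y) =
      fderiv ℝ (tangent (type6Surface u v) b) (x, y) (direction a) +
      fun k => ∑ i, ∑ j, christoffel (type6Surface u v (x, y)) k i j *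
        tangent (type6Surface u v) a (x, y) i * tangent (type6Surface u v) b (x, y) j :=
    fun a b => rfl
  have s00 : secondForm (type6Surface u v) (x, y) N 0 0 = t * (deriv u x *
      (x + (v y - y * deriv v y) / 2 - deriv u x * deriv v y) - deriv (deriv u) x) := by
    simp only [secondForm, Matrix.of_apply, hcov, christoffel_sum, t0, d00, c0, metric, h0, h1, h2]
    simp [contactForm, type6Surface_apply]
    ring
  have s10 : secondForm (type6Surface u v) (x, y) N 1 0 = t *
      ((x + (v y - y * deriv v y) / 2) ^ 2 - deriv u x ^ 2 * deriv v y ^ 2 -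
        deriv u x ^ 2 - 1) / 2 := by
    simp only [secondForm, Matrix.of_apply, hcov, christoffel_sum, t0, t1, d10, c0, c1, metric,
      h0, h1, h2]
    simp [contactForm, type6Surface_apply]
    ring
  have s01 : secondForm (type6Surface u v) (x, y) N 0 1 = t *
      ((x + (v y - y * deriv v y) / 2) ^ 2 - deriv u x ^ 2 * deriv v y ^ 2 -
        deriv u x ^ 2 - 1) / 2 := by
    simp only [secondForm, Matrix.of_apply, hcov, christoffel_sum, t0, t1, d01, c0, c1, metric,
      h0, h1, h2]
    simp [contactForm, type6Surface_apply]
    ring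
  have s11 : secondForm (type6Surface u v) (x, y) N 1 1 = t *
      (deriv v y * (x + (v y - y * deriv v y) / 2) *
        (x + (v y - y * deriv v y) / 2 - deriv u x * deriv v y) +
        deriv u x * (deriv (deriv v) y - (x + (v y - y * deriv v y) / 2)) +
        y * deriv (deriv v) y / 2) := by
    simp only [secondForm, Matrix.of_apply, hcov, christoffel_sum, t1, d11, c1, metric,
      h0, h1, h2]
    simp [contactForm, type6Surface_apply]
    ring
  have f00 : firstForm (type6Surface u v) (x, y) 0 0 = 1 + deriv u x ^ 2 := by
    simp only [firstForm, Matrix.of_apply, t0, metric, c0]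
    simp; ring
  have f01 : firstForm (type6Surface u v) (x, y) 0 1 =
      deriv v y + deriv u x * (x + (v y - y * deriv v y) / 2) := by
    simp only [firstForm, Matrix.of_apply, t0, t1, metric, c0, c1]
    simp
  have f10 : firstForm (type6Surface u v) (x, y) 1 0 =
      deriv v y + deriv u x * (x + (v y - y * deriv v y) / 2) := by
    simp only [firstForm, Matrix.of_apply, t0, t1, metric, c0, c1]
    simp; ring
  have f11 : firstForm (type6Surface u v) (x, y) 1 1 =
      1 + deriv v y ^ 2 + (x + (v y - y * deriv v y) / 2) ^ 2 := by
    simp only [firstForm, Matrix.of_apply, t1, metric, c1]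
    simp; ring
  rw [meanCurvature, trace_inv_mul_fin_two, s00, s10, s01, s11, f00, f01, f10, f11, minimalDefect]
  generalize x + (v y - y * deriv v y) / 2 = w
  -- Lagrange's identity: the Gram determinant is the squared length of the cross product.
  have hdet : (1 + deriv u x ^ 2) * (1 + deriv v y ^ 2 + w ^ 2) -
      (deriv v y + deriv u x * w) * (deriv v y + deriv u x * w) =
      (w - deriv u x * deriv v y) ^ 2 + deriv u x ^ 2 + 1 := by ring
  have hpos : (w - deriv u x * deriv v y) ^ 2 + deriv u x ^ 2 + 1 ≠ 0 := by positivity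
  rw [hdet]
  field_simp
  ring

end Surface

/-! ### Minimality as a differential equation. -/

lemma _root_.ContDiffOn.differentiableAt_of_isOpen_infty {f : ℝ → ℝ} {s : Set ℝ}
    (hs : IsOpen s) (hf : ContDiffOn ℝ ∞ f s) {x : ℝ} (hx : x ∈ s) :
    DifferentiableAt ℝ f x :=
  ((hf x hx).contDiffAt (hs.mem_nhds hx)).differentiableAt (by simp)

lemma _root_.ContDiffOn.deriv_of_isOpen_infty {f : ℝ → ℝ} {s : Set ℝ}
    (hs : IsOpen s) (hf : ContDiffOn ℝ ∞ f s) : ContDiffOn ℝ ∞ (deriv f) s :=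
  hf.deriv_of_isOpen hs (by simp)

theorem isMinimal_type6Surface_iff {I J : Set ℝ} (hI : IsOpen I) (hJ : IsOpen J) {u v : ℝ → ℝ}
    (hu : ContDiffOn ℝ ∞ u I) (hv : ContDiffOn ℝ ∞ v J) :
    IsMinimal (type6Surface u v) (I ×ˢ J) ↔ ∀ x ∈ I, ∀ y ∈ J, minimalDefect u v x y = 0 := by
  have hdu : ∀ x ∈ I, ∀ᶠ t in nhds x, DifferentiableAt ℝ u t := fun x hx =>
    Filter.mem_of_superset (hI.mem_nhds hx) fun t ht => hu.differentiableAt_of_isOpen_infty hI ht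
  have hdv : ∀ x ∈ J, ∀ᶠ t in nhds x, DifferentiableAt ℝ v t := fun x hx =>
    Filter.mem_of_superset (hJ.mem_nhds hx) fun t ht => hv.differentiableAt_of_isOpen_infty hJ ht
  have hdu2 : ∀ x ∈ I, DifferentiableAt ℝ (deriv u) x := fun x hx =>
    (hu.deriv_of_isOpen_infty hI).differentiableAt_of_isOpen_infty hI hx
  have hdv2 : ∀ x ∈ J, DifferentiableAt ℝ (deriv v) x := fun x hx =>
    (hv.deriv_of_isOpen_infty hJ).differentiableAt_of_isOpen_infty hJ hx
  constructor
  · rintro ⟨-, h⟩ x hx y hy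
    obtain ⟨-, hN⟩ := h (x, y) ⟨hx, hy⟩
    set w := x + (v y - y * deriv v y) / 2 with hw
    set D := (w - deriv u x * deriv v y) ^ 2 + deriv u x ^ 2 + 1 with hD
    have hDpos : 0 < D := by positivity
    -- A unit normal must be exhibited, since vanishing curvature is only asserted for given
    -- normals.
    set t := (Real.sqrt D)⁻¹ with ht
    have htpos : 0 < t := by positivity
    have htD : t ^ 2 * D = 1 := by
      rw [ht, inv_pow, Real.sq_sqrt hDpos.le, inv_mul_cancel₀ hDpos.ne']
    set P := type6Surface u v (x, y) with hP
    -- The last coordinate is solved from `contactForm P N = -t`.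
    let N : Nil3 := ![t * (w - deriv u x * deriv v y), t * deriv u x,
      -t - (P 1 * (t * (w - deriv u x * deriv v y)) - P 0 * (t * deriv u x)) / 2]
    have hc : contactForm P N = -t := by simp [contactForm, N]
    have hun : IsUnitNormal (type6Surface u v) (x, y) N :=
      (isUnitNormal_type6Surface (hdu x hx).self_of_nhds (hdv y hy).self_of_nhds N).2
        ⟨t, htD, rfl, rfl, hc⟩
    have := hN N hun
    rw [meanCurvature_type6Surface (hdu x hx) (hdv y hy) (hdu2 x hx) (hdv2 y hy)
      (t := t) rfl rfl hc] at this
    refine (mul_eq_zero.1 this).resolve_left ?_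
    positivity
  · intro h
    refine ⟨?_, ?_⟩
    · rw [type6Surface_eq, contDiffOn_pi]
      have hu' : ContDiffOn ℝ ∞ (fun q : ℝ × ℝ => u q.1) (I ×ˢ J) :=
        hu.comp contDiff_fst.contDiffOn fun q hq => hq.1
      have hv' : ContDiffOn ℝ ∞ (fun q : ℝ × ℝ => v q.2) (I ×ˢ J) :=
        hv.comp contDiff_snd.contDiffOn fun q hq => hq.2
      intro i
      fin_cases i
      · exact contDiff_snd.contDiffOn
      · exact contDiff_fst.contDiffOn.add hv'
      · exact hu'.add ((contDiff_fst.mul contDiff_snd).div_const 2).contDiffOn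
    · rintro ⟨x, y⟩ ⟨hx, hy⟩
      have du := (hdu x hx).self_of_nhds
      have dv := (hdv y hy).self_of_nhds
      refine ⟨?_, fun N hN => ?_⟩
      · obtain ⟨t0, t1⟩ := tangent_type6Surface du dv
        rw [Fintype.linearIndependent_iff]
        intro g hg
        rw [Fin.sum_univ_two, t0, t1] at hg
        have e0 : g 1 = 0 := by simpa using congrFun hg 0
        have e1 : g 0 = 0 := by simpa [e0] using congrFun hg 1
        intro i
        fin_cases i
        · exact e1
        · exact e0
      · obtain ⟨t, -, h0, h1, h2⟩ := (isUnitNormal_type6Surface du dv N).1 hN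
        rw [meanCurvature_type6Surface (hdu x hx) (hdv y hy) (hdu2 x hx) (hdv2 y hy) h0 h1 h2,
          h x hx y hy, mul_zero]

end Nil3

/-! ### The case of nonvanishing v''. -/

namespace Nil3

/-- The device for differentiating an identity that holds on an open set. -/
lemma hasDerivAt_eq_zero_of_eqOn_zero {f : ℝ → ℝ} {f' x : ℝ} {s : Set ℝ} (hs : IsOpen s)
    (hf : ∀ t ∈ s, f t = 0) (hx : x ∈ s) (h : HasDerivAt f f' x) : f' = 0 := by
  refine h.unique ((hasDerivAt_const x (0 : ℝ)).congr_of_eventuallyEq ?_)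
  exact Filter.mem_of_superset (hs.mem_nhds hx) hf

lemma exists_const_of_hasDerivAt_zero {f : ℝ → ℝ} {s : Set ℝ} (hs : IsOpen s)
    (hs' : s.OrdConnected) (h : ∀ x ∈ s, HasDerivAt f 0 x) : ∃ c, ∀ x ∈ s, f x = c :=
  hs.exists_is_const_of_deriv_eq_zero hs'.isPreconnected
    (fun x hx => (h x hx).differentiableAt.differentiableWithinAt) fun x hx => (h x hx).deriv

lemma quartic_coeff_eq_zero {a₀ a₁ a₂ a₃ a₄ t₀ : ℝ}
    (h : ∀ᶠ t in nhds t₀, a₀ + a₁ * t + a₂ * t ^ 2 + a₃ * t ^ 3 + a₄ * t ^ 4 = 0) :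
    a₂ = 0 ∧ a₃ = 0 ∧ a₄ = 0 := by
  open Polynomial in
  have hP : (C a₀ + C a₁ * X + C a₂ * X ^ 2 + C a₃ * X ^ 3 + C a₄ * X ^ 4 : ℝ[X]) = 0 := by
    refine eq_zero_of_infinite_isRoot _ ((infinite_of_mem_nhds t₀ h).mono fun t ht => ?_)
    simpa [IsRoot] using ht
  refine ⟨?_, ?_, ?_⟩
  · simpa [Polynomial.coeff_X, Polynomial.coeff_C] using congrArg (fun P => P.coeff 2) hP
  · simpa [Polynomial.coeff_X, Polynomial.coeff_C] using congrArg (fun P => P.coeff 3) hP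
  · simpa [Polynomial.coeff_X, Polynomial.coeff_C] using congrArg (fun P => P.coeff 4) hP

/-- A function which satisfies an autonomous cubic equation `p' = (1 + p²) (κ p + l)` together
with `(x - B) p' = p / 2 - (1 + p²) (m p + n)` is locally constant. -/
lemma deriv_eq_zero_of_two_odes {I : Set ℝ} (hI : IsOpen I) {p P : ℝ → ℝ} {κ l B m n : ℝ}
    (hpc : ContDiffOn ℝ ∞ p I) (hp : ∀ x ∈ I, HasDerivAt p (P x) x)
    (h1 : ∀ x ∈ I, P x = (1 + p x ^ 2) * (κ * p x + l))
    (h2 : ∀ x ∈ I, (x - B) * P x = p x / 2 - (1 + p x ^ 2) * (m * p x + n)) :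
    ∀ x ∈ I, P x = 0 := by
  -- Insert `h1` into `h2`, differentiate, and eliminate (x - B) P by `h2` and P by `h1`: a quartic
  -- in p alone remains.
  have hQ : ∀ x ∈ I, (l * m - κ * n) * (1 + p x ^ 2) ^ 2 +
      (1 + p x ^ 2) * (2 * κ * p x + l) / 2 + p x ^ 2 * (κ * p x + l) = 0 := by
    intro x hx
    have hd := (((hasDerivAt_id x).sub_const B).mul
      ((((hp x hx).pow 2).const_add 1).mul (((hp x hx).const_mul κ).add_const l))).sub
      (((hp x hx).div_const 2).sub ((((hp x hx).pow 2).const_add 1).mul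
        (((hp x hx).const_mul m).add_const n)))
    have hz := hasDerivAt_eq_zero_of_eqOn_zero hI (fun t ht => by
      have e := h2 t ht
      rw [h1 t ht] at e
      simpa using sub_eq_zero.2 e) hx hd
    have e2 := h2 x hx
    simp at hz
    have e1 := h1 x hx
    linear_combination hz + (1 / 2 - 2 * p x * (m * p x + n) - (1 + p x ^ 2) * m) * e1 -
      (κ * (1 + p x ^ 2) + 2 * p x * (κ * p x + l)) * e2
  intro x hx
  by_contra hne
  -- Where P ≠ 0, p maps neighbourhoods onto neighbourhoods, so the quartic vanishes near `p x` and
  -- its coefficients are zero.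
  have hstrict : HasStrictDerivAt p (P x) x :=
    ((hpc x hx).contDiffAt (hI.mem_nhds hx)).hasStrictDerivAt' (hp x hx) (by simp)
  have hev : ∀ᶠ t in nhds (p x), (l * m - κ * n) * (1 + t ^ 2) ^ 2 +
      (1 + t ^ 2) * (2 * κ * t + l) / 2 + t ^ 2 * (κ * t + l) = 0 := by
    rw [← hstrict.map_nhds_eq hne, Filter.eventually_map]
    exact Filter.mem_of_superset (hI.mem_nhds hx) hQ
  obtain ⟨c2, c3, c4⟩ := quartic_coeff_eq_zero (a₀ := (l * m - κ * n) + l / 2) (a₁ := κ)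
    (a₂ := 2 * (l * m - κ * n) + 3 / 2 * l) (a₃ := 2 * κ) (a₄ := l * m - κ * n)
    (hev.mono fun t ht => by linear_combination ht)
  have hκ : κ = 0 := by linarith
  have hl : l = 0 := by linarith
  apply hne
  rw [h1 x hx, hκ, hl]
  ring

/-- If the minimal surface equation holds and the second derivative of `v` does not vanish,
then `u` is locally constant. -/
lemma eq_zero_of_curved {I J : Set ℝ} (hI : IsOpen I) (hJ : IsOpen J) (hJne : J.Nonempty)
    {p P v q V m m₁ m₂ : ℝ → ℝ}
    (hpc : ContDiffOn ℝ ∞ p I) (hp : ∀ x ∈ I, HasDerivAt p (P x) x)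
    (hv : ∀ y ∈ J, HasDerivAt v (q y) y) (hq : ∀ y ∈ J, HasDerivAt q (V y) y)
    (hV : ∀ y ∈ J, HasDerivAt V (m y * V y) y) (hm : ∀ y ∈ J, HasDerivAt m (m₁ y) y)
    (hm₁ : ∀ y ∈ J, HasDerivAt m₁ (m₂ y) y) (hV0 : ∀ y ∈ J, V y ≠ 0)
    (hE : ∀ x ∈ I, ∀ y ∈ J, -(1 + q y ^ 2 + (x + (v y - y * q y) / 2) ^ 2) * P x +
      (1 + p x ^ 2) * (p x + y / 2) * V y + p x * (x + (v y - y * q y) / 2) + q y = 0) :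
    ∀ x ∈ I, p x = 0 := by
  have hh : ∀ y ∈ J, HasDerivAt (fun y => (v y - y * q y) / 2) (-(y * V y) / 2) y := by
    intro y hy
    have := ((hv y hy).sub ((hasDerivAt_id y).mul (hq y hy))).div_const 2
    refine this.congr_deriv ?_
    simp
  -- The y-derivative of `hE` divided by V; every term has the factor V because w_y = -yV/2 and V' =
  -- mV.
  have E1 : ∀ x ∈ I, ∀ y ∈ J, -(2 * q y - y * (x + (v y - y * q y) / 2)) * P x +
      (1 + p x ^ 2) * (1 / 2 + (p x + y / 2) * m y) - p x * y / 2 + 1 = 0 := by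
    intro x hx y hy
    have hd := (((((((hq y hy).pow 2).const_add 1).add (((hh y hy).const_add x).pow 2)).neg.mul_const
      (P x)).add (((((hasDerivAt_id y).div_const 2).const_add (p x)).const_mul
      (1 + p x ^ 2)).mul (hV y hy))).add (((hh y hy).const_add x).const_mul (p x))).add (hq y hy)
    have hz := hasDerivAt_eq_zero_of_eqOn_zero hJ (fun t ht => by simpa using hE x hx t ht) hy hd
    simp at hz
    refine (mul_eq_zero.1 (?_ : V y * _ = 0)).resolve_left (hV0 y hy)
    linear_combination hz
  have E2 : ∀ x ∈ I, ∀ y ∈ J,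
      -(2 * V y - (x + (v y - y * q y) / 2) + y ^ 2 * V y / 2) * P x +
      (1 + p x ^ 2) * (m y / 2 + (p x + y / 2) * m₁ y) - p x / 2 = 0 := by
    intro x hx y hy
    have hd := ((((((hq y hy).const_mul 2).sub
      ((hasDerivAt_id y).mul ((hh y hy).const_add x))).neg.mul_const (P x)).add
      ((((((hasDerivAt_id y).div_const 2).const_add (p x)).mul (hm y hy)).const_add
        (1 / 2)).const_mul (1 + p x ^ 2))).sub
      (((hasDerivAt_id y).const_mul (p x)).div_const 2)).add_const 1
    have hz := hasDerivAt_eq_zero_of_eqOn_zero hJ (fun t ht => by simpa using E1 x hx t ht) hy hd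
    simp at hz
    linear_combination hz
  -- A third y-derivative leaves x only through p and P.
  have E3 : ∀ x ∈ I, ∀ y ∈ J,
      -(V y * (2 * m y + 3 / 2 * y + y ^ 2 * m y / 2)) * P x +
      (1 + p x ^ 2) * (m₁ y + (p x + y / 2) * m₂ y) = 0 := by
    intro x hx y hy
    have hd := (((((((hV y hy).const_mul 2).sub ((hh y hy).const_add x)).add
      ((((hasDerivAt_id y).pow 2).mul (hV y hy)).div_const 2)).neg.mul_const (P x)).add
      ((((hm y hy).div_const 2).add
        ((((hasDerivAt_id y).div_const 2).const_add (p x)).mul (hm₁ y hy))).const_mul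
        (1 + p x ^ 2)))).sub_const (p x / 2)
    have hz := hasDerivAt_eq_zero_of_eqOn_zero hJ (fun t ht => by simpa using E2 x hx t ht) hy hd
    simp at hz
    linear_combination hz
  have hP : ∀ x ∈ I, P x = 0 := by
    by_cases hα : ∃ y ∈ J, 2 * m y + 3 / 2 * y + y ^ 2 * m y / 2 ≠ 0
    · obtain ⟨y, hy, hα⟩ := hα
      have hα' : V y * (2 * m y + 3 / 2 * y + y ^ 2 * m y / 2) ≠ 0 := mul_ne_zero (hV0 y hy) hα
      refine deriv_eq_zero_of_two_odes hI hpc hp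
        (κ := m₂ y / (V y * (2 * m y + 3 / 2 * y + y ^ 2 * m y / 2)))
        (l := (m₁ y + y / 2 * m₂ y) / (V y * (2 * m y + 3 / 2 * y + y ^ 2 * m y / 2)))
        (B := 2 * V y - (v y - y * q y) / 2 + y ^ 2 * V y / 2) (m := m₁ y)
        (n := m y / 2 + y / 2 * m₁ y) (fun x hx => ?_) (fun x hx => ?_)
      · have := E3 x hx y hy
        generalize V y * (2 * m y + 3 / 2 * y + y ^ 2 * m y / 2) = α at hα' this
        field_simp
        linear_combination -2 * this
      · linear_combination E2 x hx y hy
    · push Not at hα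
      have h3 : ∀ x ∈ I, ∀ y ∈ J, m₁ y + (p x + y / 2) * m₂ y = 0 := by
        intro x hx y hy
        have := E3 x hx y hy
        rw [hα y hy] at this
        have hpos : 1 + p x ^ 2 ≠ 0 := by positivity
        refine (mul_eq_zero.1 ?_).resolve_left hpos
        linear_combination this
      by_cases hm2 : ∃ y ∈ J, m₂ y ≠ 0
      -- Here `h3` at this y gives p = -y/2 - m₁/m₂, a constant.
      · obtain ⟨y, hy, hne⟩ := hm2
        intro x hx
        refine hasDerivAt_eq_zero_of_eqOn_zero hI (fun t ht => ?_) hx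
          ((hp x hx).add_const (y / 2 + m₁ y / m₂ y))
        have := h3 t ht y hy
        field_simp
        linear_combination 2 * this
      · push Not at hm2
        intro x hx
        exfalso
        have hm1 : ∀ y ∈ J, m₁ y = 0 := fun y hy => by
          have := h3 x hx y hy
          rwa [hm2 y hy, mul_zero, add_zero] at this
        -- Since m' = 0, differentiating `hα` gives ym + 3/2 = 0; differentiating once more gives m
        -- = 0, a contradiction.
        have F1 : ∀ y ∈ J, y * m y + 3 / 2 = 0 := by
          intro y hy
          have hd := (((hm y hy).const_mul 2).add ((hasDerivAt_id y).const_mul (3 / 2))).add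
            ((((hasDerivAt_id y).pow 2).mul (hm y hy)).div_const 2)
          have hz := hasDerivAt_eq_zero_of_eqOn_zero hJ (fun t ht => by simpa using hα t ht) hy hd
          simp [hm1 y hy] at hz
          linear_combination hz
        obtain ⟨y, hy⟩ := hJne
        have hd := ((hasDerivAt_id y).mul (hm y hy)).add_const (3 / 2)
        have hz := hasDerivAt_eq_zero_of_eqOn_zero hJ (fun t ht => by simpa using F1 t ht) hy hd
        simp [hm1 y hy] at hz
        have := F1 y hy
        rw [hz] at this
        norm_num at this
  intro x hx
  obtain ⟨y, hy⟩ := hJne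
  have hp0 : HasDerivAt p 0 x := hP x hx ▸ hp x hx
  -- With p locally constant, `hE` depends on x only through the term p x, so its x-derivative is p.
  have hd := ((((hp0.pow 2).const_add 1).mul (hp0.add_const (y / 2))).mul_const (V y)).add
    (hp0.mul ((hasDerivAt_id x).add_const ((v y - y * q y) / 2))) |>.add_const (q y)
  have hz := hasDerivAt_eq_zero_of_eqOn_zero hI (fun t ht => by
    have := hE t ht y hy
    rw [hP t ht, mul_zero, zero_add] at this
    simpa using this) hx hd
  simpa using hz

end Nil3

/-! ### Integration of the equation and the two families. -/

namespace Nil3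

lemma deriv_eq_of_eqOn_isOpen {f g : ℝ → ℝ} {g' x : ℝ} {s : Set ℝ} (hs : IsOpen s)
    (hfg : ∀ t ∈ s, f t = g t) (hx : x ∈ s) (h : HasDerivAt g g' x) : deriv f x = g' :=
  (h.congr_of_eventuallyEq (Filter.mem_of_superset (hs.mem_nhds hx) hfg)).deriv

lemma hasDerivAt_of_contDiffOn {f : ℝ → ℝ} {s : Set ℝ} (hs : IsOpen s) (hf : ContDiffOn ℝ ∞ f s) :
    ∀ x ∈ s, HasDerivAt f (deriv f x) x := fun _ hx =>
  (hf.differentiableAt_of_isOpen_infty hs hx).hasDerivAt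

lemma sqrt_quadratic_pos (a b x : ℝ) : 0 < Real.sqrt (4 * (1 + a ^ 2) + (2 * x + b) ^ 2) :=
  Real.sqrt_pos.2 (by positivity)

lemma sq_sqrt_quadratic (a b x : ℝ) :
    Real.sqrt (4 * (1 + a ^ 2) + (2 * x + b) ^ 2) ^ 2 = 4 * (1 + a ^ 2) + (2 * x + b) ^ 2 :=
  Real.sq_sqrt (by positivity)

lemma hasDerivAt_sqrt_quadratic (a b x : ℝ) :
    HasDerivAt (fun x => Real.sqrt (4 * (1 + a ^ 2) + (2 * x + b) ^ 2))
      (2 * (2 * x + b) / Real.sqrt (4 * (1 + a ^ 2) + (2 * x + b) ^ 2)) x := by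
  have h := (((((hasDerivAt_id x).const_mul 2).add_const b).pow 2).const_add
    (4 * (1 + a ^ 2))).sqrt (by simp; positivity)
  refine (h.congr_deriv ?_)
  have := sqrt_quadratic_pos a b x
  simp
  field_simp

/-- With s = 2x + b and R² = 4(1 + a²) + s², the last two terms contribute c₁ (R² + s² + 4(1 + a²))
/ (2R) = c₁ R. -/
lemma hasDerivAt_profile (a b c c₁ x : ℝ) :
    HasDerivAt (fun x => (a * x ^ 2 + a * b * x + c) / (2 * (1 + a ^ 2))
          + c₁ * (x / 2 + b / 4) * Real.sqrt (4 * (1 + a ^ 2) + (2 * x + b) ^ 2)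
          + c₁ * (1 + a ^ 2) *
            Real.log (2 * x + b + Real.sqrt (4 * (1 + a ^ 2) + (2 * x + b) ^ 2)))
      (a * (x + b / 2) / (1 + a ^ 2) + c₁ * Real.sqrt (4 * (1 + a ^ 2) + (2 * x + b) ^ 2)) x := by
  have hR := hasDerivAt_sqrt_quadratic a b x
  have hRpos := sqrt_quadratic_pos a b x
  have hRsq := sq_sqrt_quadratic a b x
  have hk : 0 < 1 + a ^ 2 := by positivity
  -- The logarithm's argument is positive because |2x + b| < R.
  have hsum : 0 < 2 * x + b + Real.sqrt (4 * (1 + a ^ 2) + (2 * x + b) ^ 2) := by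
    have := abs_lt_of_sq_lt_sq (a := 2 * x + b) (by rw [hRsq]; linarith) hRpos.le
    linarith [(abs_lt.1 this).1]
  have h := ((((((hasDerivAt_id x).pow 2).const_mul a).add
    ((hasDerivAt_id x).const_mul (a * b))).add_const c).div_const (2 * (1 + a ^ 2))).add
    (((((hasDerivAt_id x).div_const 2).add_const (b / 4)).const_mul c₁).mul hR) |>.add
    ((((((hasDerivAt_id x).const_mul 2).add_const b).add hR).log
      (by simpa using hsum.ne')).const_mul (c₁ * (1 + a ^ 2)))
  refine h.congr_deriv ?_
  simp
  generalize Real.sqrt (4 * (1 + a ^ 2) + (2 * x + b) ^ 2) = R at *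
  have e : (2 + 2 * (2 * x + b) / R) / (2 * x + b + R) = 2 / R := by
    field_simp
    ring
  rw [e]
  field_simp
  linear_combination (-4 * c₁ * (1 + a ^ 2)) * hRsq

theorem classification_of_minimalDefect {I J : Set ℝ}
    (hI : IsOpen I) (hIc : I.OrdConnected) (hIne : I.Nonempty)
    (hJ : IsOpen J) (hJc : J.OrdConnected) (hJne : J.Nonempty)
    {u v : ℝ → ℝ} (hu : ContDiffOn ℝ ∞ u I) (hv : ContDiffOn ℝ ∞ v J)
    (hE : ∀ x ∈ I, ∀ y ∈ J, minimalDefect u v x y = 0) :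
    (∃ u₀ a b : ℝ, (∀ x ∈ I, u x = u₀) ∧
        ((0 : ℝ) ∈ J → a = 0) ∧ (∀ y ∈ J, v y = a / y + b)) ∨
      (∃ a b c c₁ : ℝ, (∀ y ∈ J, v y = a * y + b) ∧
        (∀ x ∈ I, u x =
          (a * x ^ 2 + a * b * x + c) / (2 * (1 + a ^ 2))
          + c₁ * (x / 2 + b / 4) * Real.sqrt (4 * (1 + a ^ 2) + (2 * x + b) ^ 2)
          + c₁ * (1 + a ^ 2) *
            Real.log (2 * x + b + Real.sqrt (4 * (1 + a ^ 2) + (2 * x + b) ^ 2)))) := by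
  have hu1 := hu.deriv_of_isOpen_infty hI
  have hv1 := hv.deriv_of_isOpen_infty hJ
  have hv2 := hv1.deriv_of_isOpen_infty hJ
  have du := hasDerivAt_of_contDiffOn hI hu
  have du1 := hasDerivAt_of_contDiffOn hI hu1
  have dv := hasDerivAt_of_contDiffOn hJ hv
  have dv1 := hasDerivAt_of_contDiffOn hJ hv1
  by_cases hcurv : ∃ y ∈ J, deriv (deriv v) y ≠ 0
  · left
    -- This set may be disconnected, but `eq_zero_of_curved` needs only an open nonempty set and
    -- concludes on all of I.
    set J' := J ∩ deriv (deriv v) ⁻¹' {0}ᶜ with hJ'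
    have hJ'o : IsOpen J' :=
      hv2.continuousOn.isOpen_inter_preimage hJ isOpen_compl_singleton
    have hsub : J' ⊆ J := inter_subset_left
    have hv2' := hv2.mono hsub
    have hV0 : ∀ y ∈ J', deriv (deriv v) y ≠ 0 := fun y hy => hy.2
    have hm : ContDiffOn ℝ ∞ (fun y => deriv (deriv (deriv v)) y / deriv (deriv v) y) J' :=
      (hv2'.deriv_of_isOpen_infty hJ'o).div hv2' hV0
    have hm1 := hm.deriv_of_isOpen_infty hJ'o
    have hp0 : ∀ x ∈ I, deriv u x = 0 := by
      refine eq_zero_of_curved hI hJ'o (by obtain ⟨y, h1, h2⟩ := hcurv; exact ⟨y, h1, h2⟩) hu1 du1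
        (fun y hy => dv y (hsub hy)) (fun y hy => dv1 y (hsub hy)) (fun y hy => ?_)
        (hasDerivAt_of_contDiffOn hJ'o hm) (hasDerivAt_of_contDiffOn hJ'o hm1) hV0
        (fun x hx y hy => hE x hx y (hsub hy))
      rw [div_mul_cancel₀ _ (hV0 y hy)]
      exact hasDerivAt_of_contDiffOn hJ'o hv2' y hy
    obtain ⟨u₀, hu₀⟩ := exists_const_of_hasDerivAt_zero hI hIc fun x hx => hp0 x hx ▸ du x hx
    have hP0 : ∀ x ∈ I, deriv (deriv u) x = 0 := fun x hx =>
      deriv_eq_of_eqOn_isOpen hI hp0 hx (hasDerivAt_const x 0)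
    obtain ⟨x, hx⟩ := hIne
    have hode : ∀ y ∈ J, y / 2 * deriv (deriv v) y + deriv v y = 0 := fun y hy => by
      have := hE x hx y hy
      rw [minimalDefect, hp0 x hx, hP0 x hx] at this
      linear_combination this
    -- Multiplying `hode` by 2y gives (y² v')' = 0.
    obtain ⟨d, hd⟩ := exists_const_of_hasDerivAt_zero hJ hJc (f := fun y => y ^ 2 * deriv v y)
      fun y hy => by
        refine (((hasDerivAt_id y).pow 2).mul (dv1 y hy)).congr_deriv ?_
        simp
        linear_combination 2 * y * hode y hy
    by_cases h0 : (0 : ℝ) ∈ J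
    · have hd0 : d = 0 := by simpa using (hd 0 h0).symm
      have hq0 : ∀ y ∈ J, deriv v y = 0 := by
        intro y hy
        by_cases hy0 : y = 0
        -- At y = 0 the first integral says nothing; the equation itself gives v' = 0.
        · have := hode y hy
          rw [hy0] at this ⊢
          simpa using this
        · have := hd y hy
          simpa [hd0, hy0] using this
      obtain ⟨b, hb⟩ := exists_const_of_hasDerivAt_zero hJ hJc fun y hy => hq0 y hy ▸ dv y hy
      exact ⟨u₀, 0, b, hu₀, fun _ => rfl, fun y hy => by simp [hb y hy]⟩
    · have hne : ∀ y ∈ J, y ≠ 0 := fun y hy h => h0 (h ▸ hy)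
      obtain ⟨b, hb⟩ := exists_const_of_hasDerivAt_zero hJ hJc (f := fun y => v y - -d * y⁻¹)
        fun y hy => by
          refine ((dv y hy).sub ((hasDerivAt_inv (hne y hy)).const_mul (-d))).congr_deriv ?_
          have := hd y hy
          have := hne y hy
          field_simp
          linear_combination hd y hy
      refine ⟨u₀, -d, b, hu₀, fun h => absurd h h0, fun y hy => ?_⟩
      rw [← hb y hy]
      ring
  · right
    push Not at hcurv
    obtain ⟨a, ha⟩ := exists_const_of_hasDerivAt_zero hJ hJc fun y hy => hcurv y hy ▸ dv1 y hy
    obtain ⟨b, hb⟩ := exists_const_of_hasDerivAt_zero hJ hJc (f := fun y => v y - a * y)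
      fun y hy => by
        refine ((dv y hy).sub ((hasDerivAt_id y).const_mul a)).congr_deriv ?_
        simp [ha y hy]
    have hb' : ∀ y ∈ J, v y = a * y + b := fun y hy => by linear_combination hb y hy
    obtain ⟨y, hy⟩ := hJne
    have hode : ∀ x ∈ I, -(1 + a ^ 2 + (x + b / 2) ^ 2) * deriv (deriv u) x +
        deriv u x * (x + b / 2) + a = 0 := fun x hx => by
      have := hE x hx y hy
      rw [minimalDefect, hcurv y hy, ha y hy, hb' y hy] at this
      linear_combination this
    have hk : 0 < 1 + a ^ 2 := by positivity
    -- Subtract the particular solution a(x + b/2)/(1 + a²) and divide by the homogeneous solution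
    -- R: the quotient is constant.
    obtain ⟨c₁, hc₁⟩ := exists_const_of_hasDerivAt_zero hI hIc
      (f := fun x => (deriv u x - a * (x + b / 2) / (1 + a ^ 2)) /
        Real.sqrt (4 * (1 + a ^ 2) + (2 * x + b) ^ 2)) fun x hx => by
        have hRpos := sqrt_quadratic_pos a b x
        have hRsq := sq_sqrt_quadratic a b x
        refine (((du1 x hx).sub ((((hasDerivAt_id x).add_const (b / 2)).const_mul a).div_const
          (1 + a ^ 2))).div (hasDerivAt_sqrt_quadratic a b x) hRpos.ne').congr_deriv ?_
        have := hode x hx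
        simp
        generalize Real.sqrt (4 * (1 + a ^ 2) + (2 * x + b) ^ 2) = R at *
        field_simp
        rw [hRsq]
        left
        linear_combination (-4 * (1 + a ^ 2)) * this
    have hp : ∀ x ∈ I, deriv u x = a * (x + b / 2) / (1 + a ^ 2) +
        c₁ * Real.sqrt (4 * (1 + a ^ 2) + (2 * x + b) ^ 2) := fun x hx => by
      have hRpos := sqrt_quadratic_pos a b x
      have := hc₁ x hx
      rw [div_eq_iff hRpos.ne'] at this
      linear_combination this
    obtain ⟨d, hd⟩ := exists_const_of_hasDerivAt_zero hI hIc fun x hx =>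
      ((du x hx).sub (hasDerivAt_profile a b 0 c₁ x)).congr_deriv (by rw [hp x hx, sub_self])
    -- The integration constant d is absorbed into c / (2(1 + a²)).
    refine ⟨a, b, 2 * (1 + a ^ 2) * d, c₁, hb', fun x hx => ?_⟩
    have := hd x hx
    simp only [Pi.sub_apply] at this
    rw [sub_eq_iff_eq_add] at this
    rw [this]
    field_simp
    ring

theorem minimalDefect_eq_zero_of_const {I J : Set ℝ} (hI : IsOpen I) (hJ : IsOpen J)
    {u v : ℝ → ℝ} {u₀ a b : ℝ} (hu : ∀ x ∈ I, u x = u₀) (ha : (0 : ℝ) ∈ J → a = 0)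
    (hv : ∀ y ∈ J, v y = a / y + b) : ∀ x ∈ I, ∀ y ∈ J, minimalDefect u v x y = 0 := by
  intro x hx y hy
  have p0 : ∀ x ∈ I, deriv u x = 0 := fun x hx =>
    deriv_eq_of_eqOn_isOpen hI hu hx (hasDerivAt_const x u₀)
  have P0 : deriv (deriv u) x = 0 :=
    deriv_eq_of_eqOn_isOpen hI p0 hx (hasDerivAt_const x 0)
  rw [minimalDefect, p0 x hx, P0]
  by_cases h0 : (0 : ℝ) ∈ J
  · have hv' : ∀ y ∈ J, v y = b := fun y hy => by simp [hv y hy, ha h0]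
    have q0 : ∀ y ∈ J, deriv v y = 0 := fun y hy =>
      deriv_eq_of_eqOn_isOpen hJ hv' hy (hasDerivAt_const y b)
    have V0 : deriv (deriv v) y = 0 :=
      deriv_eq_of_eqOn_isOpen hJ q0 hy (hasDerivAt_const y 0)
    rw [q0 y hy, V0]
    ring
  · have hne : ∀ y ∈ J, y ≠ 0 := fun y hy h => h0 (h ▸ hy)
    have q0 : ∀ y ∈ J, deriv v y = a * -(y ^ 2)⁻¹ := fun y hy =>
      deriv_eq_of_eqOn_isOpen hJ hv hy (((hasDerivAt_inv (hne y hy)).const_mul a).add_const b)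
    have hyne := hne y hy
    have V0 : deriv (deriv v) y = a * (2 / y ^ 3) := by
      refine deriv_eq_of_eqOn_isOpen hJ q0 hy ((((hasDerivAt_id y).pow 2).inv
        (by simpa using hyne)).neg.const_mul a |>.congr_deriv ?_)
      simp
      field_simp
    rw [q0 y hy, V0]
    field_simp
    ring

theorem minimalDefect_eq_zero_of_profile {I J : Set ℝ} (hI : IsOpen I) (hJ : IsOpen J)
    {u v : ℝ → ℝ} {a b c c₁ : ℝ} (hv : ∀ y ∈ J, v y = a * y + b)
    (hu : ∀ x ∈ I, u x =
          (a * x ^ 2 + a * b * x + c) / (2 * (1 + a ^ 2))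
          + c₁ * (x / 2 + b / 4) * Real.sqrt (4 * (1 + a ^ 2) + (2 * x + b) ^ 2)
          + c₁ * (1 + a ^ 2) *
            Real.log (2 * x + b + Real.sqrt (4 * (1 + a ^ 2) + (2 * x + b) ^ 2))) :
    ∀ x ∈ I, ∀ y ∈ J, minimalDefect u v x y = 0 := by
  intro x hx y hy
  have q0 : ∀ y ∈ J, deriv v y = a := fun y hy =>
    deriv_eq_of_eqOn_isOpen hJ hv hy
      ((((hasDerivAt_id y).const_mul a).add_const b).congr_deriv (mul_one a))
  have V0 : deriv (deriv v) y = 0 :=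
    deriv_eq_of_eqOn_isOpen hJ q0 hy (hasDerivAt_const y a)
  have p0 := fun x hx => deriv_eq_of_eqOn_isOpen hI hu hx (hasDerivAt_profile a b c c₁ x)
  have P0 := deriv_eq_of_eqOn_isOpen hI p0 hx
    (((((hasDerivAt_id x).add_const (b / 2)).const_mul a).div_const (1 + a ^ 2)).add
      ((hasDerivAt_sqrt_quadratic a b x).const_mul c₁))
  rw [minimalDefect, q0 y hy, V0, p0 x hx, P0, hv y hy]
  have hRpos := sqrt_quadratic_pos a b x
  have hRsq := sq_sqrt_quadratic a b x
  generalize Real.sqrt (4 * (1 + a ^ 2) + (2 * x + b) ^ 2) = R at *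
  have hk : 0 < 1 + a ^ 2 := by positivity
  linear_combination (-a) * mul_inv_cancel₀ hk.ne' + (c₁ * (2 * x + b) * R⁻¹ / 2) * hRsq -
    (c₁ * (2 * x + b) / 2 * R) * mul_inv_cancel₀ hRpos.ne'

end Nil3

theorem theorem6 (I J : Set ℝ)
    (hIopen : IsOpen I) (hIconn : I.OrdConnected) (hIne : I.Nonempty)
    (hJopen : IsOpen J) (hJconn : J.OrdConnected) (hJne : J.Nonempty)
    (u v : ℝ → ℝ) (hu : ContDiffOn ℝ ∞ u I) (hv : ContDiffOn ℝ ∞ v J) :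
    (∀ x y : ℝ, Nil3.type6Surface u v (x, y) = ![y, x + v y, u x + x * y / 2]) ∧
    (Nil3.IsMinimal (Nil3.type6Surface u v) (I ×ˢ J) ↔
      (∃ u₀ a b : ℝ, (∀ x ∈ I, u x = u₀) ∧
        ((0 : ℝ) ∈ J → a = 0) ∧ (∀ y ∈ J, v y = a / y + b)) ∨
      (∃ a b c c₁ : ℝ, (∀ y ∈ J, v y = a * y + b) ∧
        (∀ x ∈ I, u x =
          (a * x ^ 2 + a * b * x + c) / (2 * (1 + a ^ 2))
          + c₁ * (x / 2 + b / 4) * Real.sqrt (4 * (1 + a ^ 2) + (2 * x + b) ^ 2)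
          + c₁ * (1 + a ^ 2) *
            Real.log (2 * x + b + Real.sqrt (4 * (1 + a ^ 2) + (2 * x + b) ^ 2))))) := by
  refine ⟨Nil3.type6Surface_apply u v, ?_⟩
  rw [Nil3.isMinimal_type6Surface_iff hIopen hJopen hu hv]
  constructor
  · exact Nil3.classification_of_minimalDefect hIopen hIconn hIne hJopen hJconn hJne hu hv
  · rintro (⟨u₀, a, b, h1, h2, h3⟩ | ⟨a, b, c, c₁, h1, h2⟩)
    · exact Nil3.minimalDefect_eq_zero_of_const hIopen hJopen h1 h2 h3
    · exact Nil3.minimalDefect_eq_zero_of_profile hIopen hJopen h1 h2
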